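/- Let $\alpha>0$ and $x_0>0$ be fixed. For $\theta>0$ let $c(x)=(1+\theta x_+^{\alpha})^{-1/2}$, where $x_+=\max(x,0)$, and $$\phi(x)=\int_0^x\frac{dy}{c(y)},\qquad M(x)=c^{1/2}(x)\,(c^{1/2})''(x)\quad (x>0).$$ For all sufficiently small $\theta>0$, $M$ is integrable on $[x_0,\infty)$ with $\int_{x_0}^{\infty}|M(y)|\,dy<2$, and there is exactly one bounded continuous function $S^{>}:[x_0,\infty)\to\mathbb C$ such that, for all $x\ge x_0$, $$S^{>}(x)=e^{-2i\phi(x)}+\frac1{2i}\left[\int_{x_0}^{x}M(y)S^{>}(y)e^{-2i(\phi(x)-\phi(y))}\,dy+\int_x^{+\infty}M(y)S^{>}(y)\,dy\right].$$ Put $$R_{x_0}=\frac1{2i}\int_{x_0}^{+\infty}M(y)S^{>}(y)\,dy .$$ Then $\frac{R_{x_0}}{\theta}$ has a limit as $\theta\to0^+$. Writing $[\alpha]$ for the integer part of $\alpha$, this limit is, for $\alpha\ge1$, $$\frac1{2i}\left[e^{-2ix_0}\sum_{p=2}^{[\alpha]+1}\frac{1}{(2i)^{p+1}}\frac{d^p}{dy^p}(y^{\alpha})\Big|_{y=x_0}+\int_{x_0}^{+\infty}\frac{e^{-2iy}}{(2i)^{[\alpha]+2}}\frac{d^{[\alpha]+2}}{dy^{[\alpha]+2}}(y^{\alpha})\,dy\right],$$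 and, for $0<\alpha<1$, $$\frac{\alpha(\alpha-1)}{(2i)^3}\int_{x_0}^{+\infty}y^{\alpha-2}e^{-2iy}\,dy ,$$ where both integrals converge absolutely. -/

import Mathlib

open Filter Topology MeasureTheory Set

noncomputable section

namespace FractionalRamp

/-- The nondimensional wave speed, given by `c⁻²(x) = 1 + θ x₊^α`. -/
def c (α θ x : ℝ) : ℝ := (Real.sqrt (1 + θ * (max x 0) ^ α))⁻¹

/-- The WKB phase `φ(x) = ∫₀ˣ dy / c(y)`. -/
def phi (α θ x : ℝ) : ℝ := ∫ y in (0 : ℝ)..x, 1 / c α θ y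

/-- The WKB amplitude `b = c^{1/2}`. -/
def b (α θ x : ℝ) : ℝ := Real.sqrt (c α θ x)

/-- The function `M = c^{1/2} (c^{1/2})''`. -/
def M (α θ x : ℝ) : ℝ := b α θ x * iteratedDeriv 2 (b α θ) x

/-- The Volterra operator
`K f (x) = (1/2i) [∫_{x₀}^x M(y) f(y) e^{-2i(φ(x)-φ(y))} dy + ∫_x^∞ M(y) f(y) dy]`. -/
def K (α θ x₀ : ℝ) (f : ℝ → ℂ) (x : ℝ) : ℂ :=
  1 / (2 * Complex.I) *
    ((∫ y in x₀..x, (M α θ y : ℂ) * f y *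
        Complex.exp (-2 * Complex.I * ((phi α θ x : ℂ) - (phi α θ y : ℂ)))) +
      ∫ y in Ioi x, (M α θ y : ℂ) * f y)

/-- `S` restricted to `[x₀, ∞)` is a bounded continuous solution of the Volterra equation
`S(x) = e^{-2iφ(x)} + K S (x)`, `x ≥ x₀`. -/
structure IsVolterraSolution (α θ x₀ : ℝ) (S : ℝ → ℂ) : Prop where
  continuousOn : ContinuousOn S (Ici x₀)
  bounded : ∃ C : ℝ, ∀ x ∈ Ici x₀, ‖S x‖ ≤ C
  equation : ∀ x ∈ Ici x₀,
    S x = Complex.exp (-2 * Complex.I * (phi α θ x : ℂ)) + K α θ x₀ S x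

/-- `R_{x₀} = (1/2i) ∫_{x₀}^∞ M(y) S(y) dy`, where `S` is the solution of the Volterra equation. -/
def R (α θ x₀ : ℝ) (S : ℝ → ℂ) : ℂ :=
  1 / (2 * Complex.I) * ∫ y in Ioi x₀, (M α θ y : ℂ) * S y

end FractionalRamp

end

/-!
The solution of the Volterra equation splits as `S = a e^{-2iφ} + B` with `B x = R α θ x S`, and

  `a' = (M/2i) (a + B e^{2iφ})`,  `B' = -(M/2i) (a e^{-2iφ} + B)`,  `a(x₀) = 1`,  `B(∞) = 0`,

so the number to be computed is `B(x₀)`. Existence and uniqueness are the contraction principle, as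
`‖K‖ ≤ ‖M‖₁ / 2`. Expanding in powers of `K` does not give the limit, however: `‖M‖₁` is only of
order `θ^{1/α}` for large `α`, and the higher terms are small only because of their oscillation.
Instead, `B` is compared with `ρ a e^{-2iφ}`, where `ρ` is a non-oscillating approximation to the
local reflection coefficient, the solution of the Riccati equation
`(2i/c) ρ = ρ' + (M/2i) (1 + ρ)²`. The error satisfies

  `(B - ρ a e^{-2iφ})' = -(M/2i) (1 + ρ) (B - ρ a e^{-2iφ}) + a e^{-2iφ} res`,

`res` being the residual of `ρ` in the Riccati equation; an integrating factor removes the first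
term, and `R` becomes `ρ(x₀) e^{-2iφ(x₀)}` minus the integral of `res` against bounded factors
(`SmallParameter.R_eq`).

The approximations are the Picard iterates `ρ₀ = 0, ρ₁, …` of the Riccati equation. Since
`x c' = -(α/2) (c - c³)`, all of them are smooth functions of `X = 1/x` and `V = c(x)`, which range
over a compact set. In these coordinates `ρ_{k+1} - ρ_k = X^{k+2} (1 - V²) V Q_k` with `Q_k` smooth
(`exists_slowReflection_sub_eq`), and `1 - V² = θ x^α V²`. So the `k`-th residual is bounded by a
multiple of `θ x^{α-k-2}`, uniformly in `θ`, and to leading order it is `θ` times a multiple of the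
`(k+2)`-th derivative of `x^α`. For `k = [α]` the bound is integrable, and dominated convergence gives the
limit: the sum over `p` comes from `ρ(x₀)`, the integral from the residual. For `α < 1` the sum is
empty and the formula is the one claimed in that case.
-/

open Filter Topology MeasureTheory Set

noncomputable section

namespace FractionalRamp

variable {α θ x x₀ : ℝ}

/-! ### The wave speed, the phase and the potential -/

theorem one_add_pos (hθ : 0 ≤ θ) (x : ℝ) : 0 < 1 + θ * (max x 0) ^ α := by
  have : 0 ≤ (max x 0) ^ α := Real.rpow_nonneg (le_max_right _ _) _
  positivity

theorem c_pos (hθ : 0 ≤ θ) (x : ℝ) : 0 < c α θ x :=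
  inv_pos.2 (Real.sqrt_pos.2 (one_add_pos hθ x))

theorem c_le_one (hθ : 0 ≤ θ) (x : ℝ) : c α θ x ≤ 1 := by
  have : 0 ≤ (max x 0) ^ α := Real.rpow_nonneg (le_max_right _ _) _
  refine inv_le_one_of_one_le₀ (Real.one_le_sqrt.2 ?_)
  nlinarith [mul_nonneg hθ this]

theorem continuous_c (hα : 0 < α) (hθ : 0 ≤ θ) : Continuous (c α θ) := by
  unfold c
  refine Continuous.inv₀ (Real.continuous_sqrt.comp ?_)
    (fun x => (Real.sqrt_pos.2 (one_add_pos hθ x)).ne')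
  exact continuous_const.add (continuous_const.mul
    ((continuous_id.max continuous_const).rpow_const fun x => Or.inr hα.le))

theorem one_sub_c_sq (hθ : 0 ≤ θ) (hx : 0 < x) :
    1 - c α θ x ^ 2 = θ * x ^ α * c α θ x ^ 2 := by
  have h := one_add_pos (α := α) hθ x
  have hs := Real.sq_sqrt h.le
  unfold c
  rw [inv_pow, hs]
  rw [max_eq_left hx.le] at h ⊢
  field_simp
  ring

theorem one_sub_c_sq_nonneg (hθ : 0 ≤ θ) (hx : 0 < x) : 0 ≤ 1 - c α θ x ^ 2 := by
  rw [one_sub_c_sq hθ hx]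
  positivity

theorem one_sub_c_sq_le (hθ : 0 ≤ θ) (hx : 0 < x) : 1 - c α θ x ^ 2 ≤ θ * x ^ α := by
  rw [one_sub_c_sq hθ hx]
  have h1 : c α θ x ^ 2 ≤ 1 := pow_le_one₀ (c_pos hθ x).le (c_le_one hθ x)
  exact mul_le_of_le_one_right (by positivity) h1

theorem tendsto_c (α x : ℝ) : Tendsto (fun θ => c α θ x) (𝓝[>] 0) (𝓝 1) := by
  have h : ContinuousAt (fun θ => c α θ x) 0 := by
    unfold c
    exact ContinuousAt.inv₀ (by fun_prop) (by simp)
  simpa [ContinuousAt, c] using h.tendsto.mono_left nhdsWithin_le_nhds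

/-- The Riccati-like identity `x c' = -(α/2) (c - c³)`, by which every expression built from `c`
and its derivatives is a polynomial in `1/x` and `c`. -/
theorem hasDerivAt_c (hθ : 0 ≤ θ) (hx : 0 < x) :
    HasDerivAt (c α θ) (-(α / 2) * x⁻¹ * (c α θ x - c α θ x ^ 3)) x := by
  have h := one_add_pos (α := α) hθ x
  have e : c α θ =ᶠ[𝓝 x] fun y => (Real.sqrt (1 + θ * y ^ α))⁻¹ := by
    filter_upwards [lt_mem_nhds hx] with y hy
    simp [c, max_eq_left hy.le]
  have ec := e.eq_of_nhds
  rw [max_eq_left hx.le] at h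
  have hs := Real.sq_sqrt h.le
  have hs0 := Real.sqrt_pos.2 h
  refine HasDerivAt.congr_of_eventuallyEq ?_ e
  have d := ((((Real.hasDerivAt_rpow_const (p := α) (Or.inl hx.ne')).const_mul θ).const_add
    1).sqrt h.ne').inv hs0.ne'
  refine d.congr_deriv ?_
  rw [ec, Real.rpow_sub_one hx.ne']
  set s := Real.sqrt (1 + θ * x ^ α)
  have : θ * x ^ α = s ^ 2 - 1 := by linarith
  field_simp
  linear_combination (-α) * this

theorem b_pos (hθ : 0 ≤ θ) (x : ℝ) : 0 < b α θ x := Real.sqrt_pos.2 (c_pos hθ x)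

theorem b_sq (hθ : 0 ≤ θ) (x : ℝ) : b α θ x ^ 2 = c α θ x := Real.sq_sqrt (c_pos hθ x).le

theorem hasDerivAt_b (hθ : 0 ≤ θ) (hx : 0 < x) :
    HasDerivAt (b α θ) (-(α / 4) * x⁻¹ * (b α θ x - b α θ x ^ 5)) x := by
  refine ((hasDerivAt_c hθ hx).sqrt (c_pos hθ x).ne').congr_deriv ?_
  have hb := b_pos (α := α) hθ x
  change _ / (2 * b α θ x) = _
  rw [← b_sq hθ x]
  field_simp
  ring

/-- `M` written in terms of `1/x` and `c` alone. It vanishes at `θ = 0`, where `c = 1`. -/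
theorem M_eq (hθ : 0 ≤ θ) (hx : 0 < x) :
    M α θ x = x⁻¹ ^ 2 * (1 - c α θ x ^ 2) * c α θ x *
      (α / 4 + α ^ 2 / 16 * (1 - 5 * c α θ x ^ 2)) := by
  have hd : deriv (b α θ) =ᶠ[𝓝 x] fun y => -(α / 4) * y⁻¹ * (b α θ y - b α θ y ^ 5) := by
    filter_upwards [lt_mem_nhds hx] with y hy using (hasDerivAt_b hθ hy).deriv
  have h := hasDerivAt_b (α := α) hθ hx
  have d2 := ((hasDerivAt_inv hx.ne').const_mul (-(α / 4))).mul (h.sub (h.pow 5))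
  rw [M, iteratedDeriv_succ, iteratedDeriv_one, (d2.congr_of_eventuallyEq hd).deriv,
    ← b_sq hθ x]
  simp only [Pi.sub_apply, Pi.pow_apply]
  field_simp
  ring

theorem continuousOn_M (hα : 0 < α) (hθ : 0 ≤ θ) : ContinuousOn (M α θ) (Ioi 0) := by
  have hc := continuous_c hα hθ
  refine ContinuousOn.congr (f := fun x => x⁻¹ ^ 2 * (1 - c α θ x ^ 2) * c α θ x *
      (α / 4 + α ^ 2 / 16 * (1 - 5 * c α θ x ^ 2))) ?_ fun x hx => M_eq hθ hx
  have : ContinuousOn (fun x : ℝ => x⁻¹) (Ioi 0) :=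
    continuousOn_inv₀.mono fun x hx => (mem_Ioi.1 hx).ne'
  fun_prop

/-- The decay of `M`, with a constant independent of `θ`. -/
theorem abs_M_le (hθ : 0 ≤ θ) (hx : 0 < x) :
    |M α θ x| ≤ (|α| / 4 + α ^ 2 / 4) * x ^ (-2 : ℝ) := by
  have h0 := c_pos (α := α) hθ x
  have h1 := c_le_one (α := α) hθ x
  have h2 := one_sub_c_sq_nonneg (α := α) hθ hx
  rw [M_eq hθ hx, Real.rpow_neg hx.le, Real.rpow_two, abs_mul, abs_mul, abs_mul,
    abs_of_pos h0, abs_of_nonneg h2, abs_of_nonneg (by positivity), ← inv_pow]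
  have h3 : |α / 4 + α ^ 2 / 16 * (1 - 5 * c α θ x ^ 2)| ≤ |α| / 4 + α ^ 2 / 4 := by
    have h4 : |1 - 5 * c α θ x ^ 2| ≤ 4 := by rw [abs_le]; constructor <;> nlinarith
    calc _ ≤ |α / 4| + |α ^ 2 / 16 * (1 - 5 * c α θ x ^ 2)| := abs_add_le _ _
      _ = |α| / 4 + α ^ 2 / 16 * |1 - 5 * c α θ x ^ 2| := by
        rw [abs_div, abs_mul, abs_of_nonneg (by positivity : 0 ≤ α ^ 2 / 16)]; norm_num
      _ ≤ _ := by nlinarith [sq_nonneg α]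
  have h5 : x⁻¹ ^ 2 * (1 - c α θ x ^ 2) * c α θ x ≤ x⁻¹ ^ 2 := by
    have : (1 - c α θ x ^ 2) * c α θ x ≤ 1 := by nlinarith [sq_nonneg (c α θ x)]
    rw [mul_assoc]
    exact mul_le_of_le_one_right (by positivity) this
  rw [mul_comm (|α| / 4 + α ^ 2 / 4)]
  exact mul_le_mul h5 h3 (abs_nonneg _) (by positivity)

theorem integrableOn_rpow_neg_two (hx₀ : 0 < x₀) (C : ℝ) :
    IntegrableOn (fun x : ℝ => C * x ^ (-2 : ℝ)) (Ioi x₀) :=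
  (integrableOn_Ioi_rpow_of_lt (by norm_num) hx₀).const_mul C

theorem aestronglyMeasurable_M (hα : 0 < α) (hx₀ : 0 < x₀) (hθ : 0 ≤ θ) :
    AEStronglyMeasurable (M α θ) (volume.restrict (Ioi x₀)) :=
  ((continuousOn_M hα hθ).mono (Ioi_subset_Ioi hx₀.le)).aestronglyMeasurable measurableSet_Ioi

theorem integrableOn_M (hα : 0 < α) (hx₀ : 0 < x₀) (hθ : 0 ≤ θ) :
    IntegrableOn (M α θ) (Ioi x₀) :=
  (integrableOn_rpow_neg_two hx₀ _).mono' (aestronglyMeasurable_M hα hx₀ hθ) <|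
    (ae_restrict_iff' measurableSet_Ioi).2 <| ae_of_all _ fun _ hx =>
      abs_M_le hθ (hx₀.trans hx)

theorem tendsto_M (hx : 0 < x) : Tendsto (fun θ => M α θ x) (𝓝[>] 0) (𝓝 0) := by
  have h := tendsto_c α x
  have : Tendsto (fun θ => x⁻¹ ^ 2 * (1 - c α θ x ^ 2) * c α θ x *
      (α / 4 + α ^ 2 / 16 * (1 - 5 * c α θ x ^ 2))) (𝓝[>] 0)
      (𝓝 (x⁻¹ ^ 2 * (1 - 1 ^ 2) * 1 * (α / 4 + α ^ 2 / 16 * (1 - 5 * 1 ^ 2)))) :=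
    ((tendsto_const_nhds.mul (tendsto_const_nhds.sub (h.pow 2))).mul h).mul
      (tendsto_const_nhds.add (tendsto_const_nhds.mul
        (tendsto_const_nhds.sub (tendsto_const_nhds.mul (h.pow 2)))))
  simp only [one_pow, sub_self, mul_zero, zero_mul] at this
  refine this.congr' ?_
  filter_upwards [self_mem_nhdsWithin] with θ hθ using (M_eq (le_of_lt hθ) hx).symm

/-- The `L¹` norm of `M` on `[x₀, ∞)` tends to `0` with `θ`: `M` is bounded by a multiple of
`x⁻²` uniformly in `θ`. -/
theorem tendsto_integral_abs_M (hα : 0 < α) (hx₀ : 0 < x₀) :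
    Tendsto (fun θ => ∫ y in Ioi x₀, |M α θ y|) (𝓝[>] 0) (𝓝 0) := by
  have h : Tendsto (fun θ => ∫ y in Ioi x₀, |M α θ y|) (𝓝[>] 0) (𝓝 (∫ _ in Ioi x₀, (0 : ℝ))) := by
    refine tendsto_integral_filter_of_dominated_convergence
      (fun x => (|α| / 4 + α ^ 2 / 4) * x ^ (-2 : ℝ)) ?_ ?_ (integrableOn_rpow_neg_two hx₀ _) ?_
    · filter_upwards [self_mem_nhdsWithin] with θ hθ
      exact (aestronglyMeasurable_M hα hx₀ (le_of_lt hθ)).norm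
    · filter_upwards [self_mem_nhdsWithin] with θ hθ
      refine (ae_restrict_iff' measurableSet_Ioi).2 (ae_of_all _ fun x hx => ?_)
      rw [Real.norm_eq_abs, abs_abs]
      exact abs_M_le (le_of_lt hθ) (hx₀.trans hx)
    · refine (ae_restrict_iff' measurableSet_Ioi).2 (ae_of_all _ fun x hx => ?_)
      simpa using (tendsto_M (α := α) (hx₀.trans hx)).abs
  simpa using h

theorem continuous_inv_c (hα : 0 < α) (hθ : 0 ≤ θ) : Continuous fun x => 1 / c α θ x :=
  continuous_const.div (continuous_c hα hθ) fun x => (c_pos hθ x).ne'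

theorem hasDerivAt_phi (hα : 0 < α) (hθ : 0 ≤ θ) (x : ℝ) :
    HasDerivAt (phi α θ) (1 / c α θ x) x :=
  (continuous_inv_c hα hθ).integral_hasStrictDerivAt 0 x |>.hasDerivAt

theorem continuous_phi (hα : 0 < α) (hθ : 0 ≤ θ) : Continuous (phi α θ) :=
  continuous_iff_continuousAt.2 fun x => (hasDerivAt_phi hα hθ x).continuousAt

theorem tendsto_phi (hα : 0 < α) (x : ℝ) :
    Tendsto (fun θ => phi α θ x) (𝓝[>] 0) (𝓝 x) := by
  have : Tendsto (fun θ => phi α θ x) (𝓝[>] 0) (𝓝 (∫ _ in (0 : ℝ)..x, (1 : ℝ))) := by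
    -- `1/c` increases with `θ`, so its values at `θ = 1` dominate.
    refine intervalIntegral.tendsto_integral_filter_of_dominated_convergence
      (fun y => 1 / c α 1 y) ?_ ?_ ((continuous_inv_c hα zero_le_one).intervalIntegrable _ _) ?_
    · filter_upwards [self_mem_nhdsWithin] with θ hθ
      exact (continuous_inv_c hα (le_of_lt hθ)).aestronglyMeasurable
    · filter_upwards [Ioo_mem_nhdsGT (zero_lt_one (α := ℝ))] with θ hθ
      refine ae_of_all _ fun y _ => ?_
      rw [Real.norm_eq_abs, abs_of_pos (one_div_pos.2 (c_pos hθ.1.le y))]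
      have : 0 ≤ (max y 0) ^ α := Real.rpow_nonneg (le_max_right _ _) _
      simp only [c, one_div, inv_inv]
      exact Real.sqrt_le_sqrt (by nlinarith [hθ.1, hθ.2])
    · refine ae_of_all _ fun y _ => ?_
      simpa using (tendsto_c α y).inv₀ one_ne_zero
  simpa using this

/-! ### The Volterra equation -/

theorem max_mem_Ici (x x₀ : ℝ) : max x x₀ ∈ Ici x₀ := mem_Ici.2 (le_max_right x x₀)

theorem continuousOn_primitive_Ici {F : ℝ → ℂ} (hF : IntegrableOn F (Ioi x₀)) :
    ContinuousOn (fun x => ∫ y in x₀..x, F y) (Ici x₀) := by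
  have h : Integrable ((Ioi x₀).indicator F) := (integrable_indicator_iff measurableSet_Ioi).2 hF
  refine (intervalIntegral.continuous_primitive (fun _ _ => h.intervalIntegrable)
    x₀).continuousOn.congr fun x hx => ?_
  simp only [intervalIntegral.integral_of_le (mem_Ici.1 hx)]
  refine setIntegral_congr_fun measurableSet_Ioc fun y hy => ?_
  exact (indicator_of_mem (mem_Ioi.2 hy.1) F).symm

theorem continuousOn_integral_Ioi {F : ℝ → ℂ} (hF : IntegrableOn F (Ioi x₀)) :
    ContinuousOn (fun x => ∫ y in Ioi x, F y) (Ici x₀) := by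
  refine (continuousOn_const.sub (continuousOn_primitive_Ici hF)).congr
    (f := fun x => (∫ y in Ioi x₀, F y) - ∫ y in x₀..x, F y) fun x hx => ?_
  simp only [← intervalIntegral.integral_Ioi_sub_Ioi hF hx, sub_sub_cancel]

theorem norm_exp_neg_two_I_mul (t : ℝ) : ‖Complex.exp (-2 * Complex.I * (t : ℂ))‖ = 1 := by
  rw [Complex.norm_exp]; simp

theorem norm_exp_two_I_mul (t : ℝ) : ‖Complex.exp (2 * Complex.I * (t : ℂ))‖ = 1 := by
  rw [Complex.norm_exp]; simp

theorem norm_one_div_two_I : ‖(1 / (2 * Complex.I) : ℂ)‖ = 1 / 2 := by simp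

theorem integrableOn_M_mul (hα : 0 < α) (hx₀ : 0 < x₀) (hθ : 0 ≤ θ) {f : ℝ → ℂ} {C : ℝ}
    (hf : ContinuousOn f (Ici x₀)) (hC : ∀ x ∈ Ici x₀, ‖f x‖ ≤ C) :
    IntegrableOn (fun y => (M α θ y : ℂ) * f y) (Ioi x₀) :=
  (integrableOn_M hα hx₀ hθ).ofReal.mul_bdd
    ((hf.mono Ioi_subset_Ici_self).aestronglyMeasurable measurableSet_Ioi)
    ((ae_restrict_iff' measurableSet_Ioi).2 <| ae_of_all _ fun x hx => hC x (mem_Ici_of_Ioi hx))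

theorem integrableOn_M_mul_exp (hα : 0 < α) (hθ : 0 ≤ θ) {f : ℝ → ℂ}
    (hf : IntegrableOn (fun y => (M α θ y : ℂ) * f y) (Ioi x₀)) :
    IntegrableOn (fun y => (M α θ y : ℂ) * f y * Complex.exp (2 * Complex.I * (phi α θ y : ℂ)))
      (Ioi x₀) := by
  have := continuous_phi hα hθ
  exact Integrable.mul_bdd hf
    (by fun_prop : Continuous fun y => Complex.exp (2 * Complex.I * (phi α θ y : ℂ))
      ).aestronglyMeasurable (ae_of_all _ fun x => (norm_exp_two_I_mul _).le)

theorem K_eq (f : ℝ → ℂ) (x : ℝ) :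
    K α θ x₀ f x = 1 / (2 * Complex.I) *
      (Complex.exp (-2 * Complex.I * (phi α θ x : ℂ)) *
        (∫ y in x₀..x, (M α θ y : ℂ) * f y * Complex.exp (2 * Complex.I * (phi α θ y : ℂ))) +
      ∫ y in Ioi x, (M α θ y : ℂ) * f y) := by
  rw [K, ← intervalIntegral.integral_const_mul]
  congr 3
  ext y
  rw [mul_sub, sub_eq_add_neg, Complex.exp_add,
    show -(-2 * Complex.I * (phi α θ y : ℂ)) = 2 * Complex.I * (phi α θ y : ℂ) by ring]
  ring

theorem continuousOn_K (hα : 0 < α) (hθ : 0 ≤ θ) {f : ℝ → ℂ}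
    (hf : IntegrableOn (fun y => (M α θ y : ℂ) * f y) (Ioi x₀)) :
    ContinuousOn (K α θ x₀ f) (Ici x₀) := by
  have h1 := continuousOn_primitive_Ici (integrableOn_M_mul_exp hα hθ hf)
  have h2 := continuousOn_integral_Ioi hf
  have h3 := continuous_phi hα hθ
  refine ContinuousOn.congr ?_ fun x _ => K_eq f x
  fun_prop

theorem K_sub (hα : 0 < α) (hθ : 0 ≤ θ) {f g : ℝ → ℂ}
    (hf : IntegrableOn (fun y => (M α θ y : ℂ) * f y) (Ioi x₀))
    (hg : IntegrableOn (fun y => (M α θ y : ℂ) * g y) (Ioi x₀)) (hx : x ∈ Ici x₀) :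
    K α θ x₀ (fun y => f y - g y) x = K α θ x₀ f x - K α θ x₀ g x := by
  have h {F : ℝ → ℂ} (hF : IntegrableOn F (Ioi x₀)) : IntervalIntegrable F volume x₀ x :=
    (intervalIntegrable_iff_integrableOn_Ioc_of_le hx).2 (hF.mono_set Ioc_subset_Ioi_self)
  have h' := Ioi_subset_Ioi (mem_Ici.1 hx)
  simp only [K_eq, mul_sub, sub_mul]
  rw [intervalIntegral.integral_sub (h (integrableOn_M_mul_exp hα hθ hf))
    (h (integrableOn_M_mul_exp hα hθ hg)), integral_sub (hf.mono_set h') (hg.mono_set h')]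
  ring

theorem norm_K_le (hα : 0 < α) (hx₀ : 0 < x₀) (hθ : 0 ≤ θ) {f : ℝ → ℂ} {C : ℝ}
    (hC : ∀ x ∈ Ici x₀, ‖f x‖ ≤ C) (hx : x ∈ Ici x₀) :
    ‖K α θ x₀ f x‖ ≤ (∫ y in Ioi x₀, |M α θ y|) / 2 * C := by
  have hM : IntegrableOn (fun y => |M α θ y| * C) (Ioi x₀) :=
    (integrableOn_M hα hx₀ hθ).abs.mul_const C
  have hb : ∀ y ∈ Ici x₀, ‖(M α θ y : ℂ) * f y‖ ≤ |M α θ y| * C := fun y hy => by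
    rw [norm_mul, Complex.norm_real, Real.norm_eq_abs]
    exact mul_le_mul_of_nonneg_left (hC y hy) (abs_nonneg _)
  have hI : IntegrableOn (fun y => |M α θ y| * C) (Ioi x) :=
    hM.mono_set (Ioi_subset_Ioi (mem_Ici.1 hx))
  have hii : IntervalIntegrable (fun y => |M α θ y| * C) volume x₀ x :=
    (intervalIntegrable_iff_integrableOn_Ioc_of_le hx).2 (hM.mono_set Ioc_subset_Ioi_self)
  have h1 : ‖∫ y in x₀..x, (M α θ y : ℂ) * f y *
      Complex.exp (-2 * Complex.I * ((phi α θ x : ℂ) - (phi α θ y : ℂ)))‖ ≤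
      ∫ y in x₀..x, |M α θ y| * C := by
    refine intervalIntegral.norm_integral_le_of_norm_le hx (ae_of_all _ fun y hy => ?_) hii
    rw [norm_mul, ← Complex.ofReal_sub, norm_exp_neg_two_I_mul, mul_one]
    exact hb y hy.1.le
  have h2 : ‖∫ y in Ioi x, (M α θ y : ℂ) * f y‖ ≤ ∫ y in Ioi x, |M α θ y| * C :=
    norm_integral_le_of_norm_le hI <| (ae_restrict_iff' measurableSet_Ioi).2 <|
      ae_of_all _ fun y hy => hb y ((mem_Ici.1 hx).trans (le_of_lt hy))
  rw [K, norm_mul, norm_one_div_two_I]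
  calc _ ≤ 1 / 2 * ((∫ y in x₀..x, |M α θ y| * C) + ∫ y in Ioi x, |M α θ y| * C) := by
        gcongr
        exact (norm_add_le _ _).trans (add_le_add h1 h2)
    _ = _ := by
        rw [intervalIntegral.integral_interval_add_Ioi hM hI, integral_mul_const]
        ring

theorem K_congr {f g : ℝ → ℂ} (h : EqOn f g (Ici x₀)) (hx : x ∈ Ici x₀) :
    K α θ x₀ f x = K α θ x₀ g x := by
  rw [K, K]
  congr 2
  · refine intervalIntegral.integral_congr fun y hy => ?_
    rw [uIcc_of_le hx] at hy
    simp only [h hy.1]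
  · refine setIntegral_congr_fun measurableSet_Ioi fun y hy => ?_
    simp only [h (mem_Ici.2 ((mem_Ici.1 hx).trans (le_of_lt hy)))]

open BoundedContinuousFunction in
theorem integrableOn_M_mul_bcf (hα : 0 < α) (hx₀ : 0 < x₀) (hθ : 0 ≤ θ) (f : ℝ →ᵇ ℂ) :
    IntegrableOn (fun y => (M α θ y : ℂ) * f y) (Ioi x₀) :=
  integrableOn_M_mul hα hx₀ hθ f.continuous.continuousOn fun x _ => f.norm_coe_le_norm x

open BoundedContinuousFunction in
/-- The right-hand side of the Volterra equation as a self-map of the bounded continuous functions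
on the line. The argument is clamped to `[x₀, ∞)`, so that the fixed points are the bounded
continuous solutions on `[x₀, ∞)`, extended to the left by their value at `x₀`. -/
def volterraMap (hα : 0 < α) (hx₀ : 0 < x₀) (hθ : 0 ≤ θ) (f : ℝ →ᵇ ℂ) : ℝ →ᵇ ℂ :=
  .ofNormedAddCommGroup
    (fun x => Complex.exp (-2 * Complex.I * (phi α θ (max x x₀) : ℂ)) + K α θ x₀ f (max x x₀))
    (by
      have h1 := continuous_phi hα hθ
      have h2 : Continuous fun x => K α θ x₀ f (max x x₀) :=
        (continuousOn_K hα hθ (integrableOn_M_mul_bcf hα hx₀ hθ f)).comp_continuous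
          (by fun_prop) fun x => max_mem_Ici x x₀
      fun_prop)
    (1 + (∫ y in Ioi x₀, |M α θ y|) / 2 * ‖f‖)
    (fun x => (norm_add_le _ _).trans (add_le_add (norm_exp_neg_two_I_mul _).le
      (norm_K_le hα hx₀ hθ (fun y _ => f.norm_coe_le_norm y) (max_mem_Ici x x₀))))

open BoundedContinuousFunction in
theorem contractingWith_volterraMap (hα : 0 < α) (hx₀ : 0 < x₀) (hθ : 0 ≤ θ)
    (hM : (∫ y in Ioi x₀, |M α θ y|) < 2) :
    ContractingWith (((∫ y in Ioi x₀, |M α θ y|) / 2).toNNReal) (volterraMap hα hx₀ hθ) := by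
  have h0 : 0 ≤ ∫ y in Ioi x₀, |M α θ y| := integral_nonneg fun _ => abs_nonneg _
  refine ⟨by rw [Real.toNNReal_lt_one]; linarith, LipschitzWith.of_dist_le_mul fun f g => ?_⟩
  rw [Real.coe_toNNReal _ (by positivity)]
  refine (dist_le (by positivity)).2 fun x => ?_
  have hx : max x x₀ ∈ Ici x₀ := max_mem_Ici x x₀
  simp only [volterraMap, coe_ofNormedAddCommGroup]
  rw [dist_add_left, dist_eq_norm, ← K_sub hα hθ (integrableOn_M_mul_bcf hα hx₀ hθ f)
    (integrableOn_M_mul_bcf hα hx₀ hθ g) hx]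
  refine norm_K_le hα hx₀ hθ (fun y _ => ?_) hx
  rw [← dist_eq_norm]
  exact dist_coe_le_dist y

theorem exists_isVolterraSolution (hα : 0 < α) (hx₀ : 0 < x₀) (hθ : 0 ≤ θ)
    (hM : (∫ y in Ioi x₀, |M α θ y|) < 2) : ∃ S, IsVolterraSolution α θ x₀ S := by
  have hT := contractingWith_volterraMap hα hx₀ hθ hM
  set f := hT.fixedPoint
  have hf : volterraMap hα hx₀ hθ f = f := hT.fixedPoint_isFixedPt
  refine ⟨f, f.continuous.continuousOn, ⟨‖f‖, fun x _ => f.norm_coe_le_norm x⟩, fun x hx => ?_⟩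
  have := DFunLike.congr_fun hf x
  simp only [volterraMap, BoundedContinuousFunction.coe_ofNormedAddCommGroup,
    max_eq_left (mem_Ici.1 hx)] at this
  exact this.symm

open BoundedContinuousFunction in
theorem IsVolterraSolution.exists_fixedPoint (hα : 0 < α) (hx₀ : 0 < x₀) (hθ : 0 ≤ θ)
    {S : ℝ → ℂ} (hS : IsVolterraSolution α θ x₀ S) :
    ∃ f : ℝ →ᵇ ℂ, volterraMap hα hx₀ hθ f = f ∧ EqOn S f (Ici x₀) := by
  obtain ⟨C, hC⟩ := hS.bounded
  let f : ℝ →ᵇ ℂ := .ofNormedAddCommGroup (fun x => S (max x x₀))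
    (hS.continuousOn.comp_continuous (by fun_prop) fun x => max_mem_Ici x x₀) C
    fun x => hC _ (max_mem_Ici x x₀)
  have hf : EqOn S f (Ici x₀) := fun x hx => by simp [f, max_eq_left (mem_Ici.1 hx)]
  refine ⟨f, ?_, hf⟩
  ext1 x
  have hx : max x x₀ ∈ Ici x₀ := max_mem_Ici x x₀
  simp only [volterraMap, coe_ofNormedAddCommGroup]
  rw [← K_congr hf hx, ← hS.equation _ hx]
  rfl

theorem IsVolterraSolution.eqOn (hα : 0 < α) (hx₀ : 0 < x₀) (hθ : 0 ≤ θ)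
    (hM : (∫ y in Ioi x₀, |M α θ y|) < 2) {S S' : ℝ → ℂ} (hS : IsVolterraSolution α θ x₀ S)
    (hS' : IsVolterraSolution α θ x₀ S') : EqOn S S' (Ici x₀) := by
  obtain ⟨f, hf, hSf⟩ := hS.exists_fixedPoint hα hx₀ hθ
  obtain ⟨g, hg, hSg⟩ := hS'.exists_fixedPoint hα hx₀ hθ
  have := (contractingWith_volterraMap hα hx₀ hθ hM).fixedPoint_unique' hf hg
  exact fun x hx => (hSf hx).trans (this ▸ (hSg hx).symm)

/-- The solution is bounded by `1 / (1 - ‖M‖₁ / 2)`, hence by `2` if `‖M‖₁ ≤ 1`. -/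
theorem IsVolterraSolution.norm_le_two (hα : 0 < α) (hx₀ : 0 < x₀) (hθ : 0 ≤ θ)
    (hM : (∫ y in Ioi x₀, |M α θ y|) ≤ 1) {S : ℝ → ℂ} (hS : IsVolterraSolution α θ x₀ S)
    (hx : x ∈ Ici x₀) : ‖S x‖ ≤ 2 := by
  obtain ⟨f, hf, hSf⟩ := hS.exists_fixedPoint hα hx₀ hθ
  have h0 : 0 ≤ ∫ y in Ioi x₀, |M α θ y| := integral_nonneg fun _ => abs_nonneg _
  have h : ‖volterraMap hα hx₀ hθ f‖ ≤ 1 + (∫ y in Ioi x₀, |M α θ y|) / 2 * ‖f‖ := by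
    unfold volterraMap
    exact BoundedContinuousFunction.norm_ofNormedAddCommGroup_le _ (by positivity) _
  rw [hf] at h
  have h2 : ‖f‖ ≤ 2 := by nlinarith [norm_nonneg f]
  rw [hSf hx]
  exact (f.norm_coe_le_norm x).trans h2

/-! ### Slow functions: smooth functions of `1/x` and `c` -/

/-- The Euler operator `x d/dx` in the coordinates `(X, V) = (1/x, c(x))`: the derivative along the
vector field `(-X, -(α/2) (V - V³))`. -/
def euler (α : ℝ) (G : ℝ × ℝ → ℂ) (p : ℝ × ℝ) : ℂ :=
  fderiv ℝ G p (-p.1, -(α / 2) * (p.2 - p.2 ^ 3))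

open scoped ContDiff in
theorem contDiff_euler {G : ℝ × ℝ → ℂ} (hG : ContDiff ℝ ∞ G) : ContDiff ℝ ∞ (euler α G) := by
  have h : ContDiff ℝ ∞ (fderiv ℝ G) := hG.fderiv_right (by simp)
  exact h.clm_apply (by fun_prop)

open scoped ContDiff in
theorem hasDerivAt_slow (hθ : 0 ≤ θ) (hx : 0 < x) {G : ℝ × ℝ → ℂ} (hG : ContDiff ℝ ∞ G) :
    HasDerivAt (fun y => G (y⁻¹, c α θ y)) ((x⁻¹ : ℝ) * euler α G (x⁻¹, c α θ x)) x := by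
  have h1 : HasDerivAt (fun y => (y⁻¹, c α θ y))
      (x⁻¹ • (-x⁻¹, -(α / 2) * (c α θ x - c α θ x ^ 3)) : ℝ × ℝ) x := by
    refine ((hasDerivAt_inv hx.ne').prodMk (hasDerivAt_c hθ hx)).congr_deriv ?_
    ext
    · simp [sq]
    · simp only [Prod.smul_mk, smul_eq_mul]
      ring
  have h2 : HasFDerivAt G (fderiv ℝ G (x⁻¹, c α θ x)) (x⁻¹, c α θ x) :=
    (hG.differentiable (by simp) _).hasFDerivAt
  refine (h2.comp_hasDerivAt x h1).congr_deriv ?_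
  rw [map_smul, Complex.real_smul, euler]

/-- `M` divided by `X² (1 - V²) V`, in the coordinates `(X, V) = (1/x, c(x))`. -/
def reducedM (α : ℝ) (p : ℝ × ℝ) : ℂ := α / 4 + α ^ 2 / 16 * (1 - 5 * (p.2 : ℂ) ^ 2)

/-- `M` in the coordinates `(X, V) = (1/x, c(x))`. -/
def slowM (α : ℝ) (p : ℝ × ℝ) : ℂ :=
  (p.1 : ℂ) ^ 2 * (1 - (p.2 : ℂ) ^ 2) * p.2 * reducedM α p

theorem M_eq_slowM (hθ : 0 ≤ θ) (hx : 0 < x) :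
    (M α θ x : ℂ) = slowM α (x⁻¹, c α θ x) := by
  rw [M_eq hθ hx, slowM, reducedM]
  push_cast
  ring

/-- The approximations to the local reflection coefficient `r`, which satisfies the Riccati equation
`(2i/c) r = r' + (M/2i) (1 + r)²`. They are the Picard iterates for this equation read as a fixed
point equation for `r`, in the coordinates `(X, V) = (1/x, c(x))`. -/
def slowReflection (α : ℝ) : ℕ → ℝ × ℝ → ℂ
  | 0 => 0
  | k + 1 => fun p => p.2 / (2 * Complex.I) * (p.1 * euler α (slowReflection α k) p +
      slowM α p / (2 * Complex.I) * (1 + slowReflection α k p) ^ 2)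

open scoped ContDiff in
theorem contDiff_ofReal_fst : ContDiff ℝ ∞ fun p : ℝ × ℝ => (p.1 : ℂ) :=
  Complex.ofRealCLM.contDiff.comp contDiff_fst

open scoped ContDiff in
theorem contDiff_ofReal_snd : ContDiff ℝ ∞ fun p : ℝ × ℝ => (p.2 : ℂ) :=
  Complex.ofRealCLM.contDiff.comp contDiff_snd

open scoped ContDiff in
theorem contDiff_reducedM : ContDiff ℝ ∞ (reducedM α) := by
  have := contDiff_ofReal_snd
  unfold reducedM
  fun_prop

open scoped ContDiff in
theorem contDiff_slowReflection (k : ℕ) : ContDiff ℝ ∞ (slowReflection α k) := by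
  induction k with
  | zero => exact contDiff_const
  | succ k ih =>
    have h1 := contDiff_ofReal_fst
    have h2 := contDiff_ofReal_snd
    have h3 := contDiff_reducedM (α := α)
    have h4 := contDiff_euler (α := α) ih
    simp only [slowReflection, slowM, div_eq_mul_inv]
    fun_prop

open scoped ContDiff in
theorem euler_mul_one_sub_sq (n : ℕ) {g : ℝ × ℝ → ℂ} (hg : ContDiff ℝ ∞ g) (p : ℝ × ℝ) :
    euler α (fun q => (q.1 : ℂ) ^ n * (1 - (q.2 : ℂ) ^ 2) * g q) p =
      (p.1 : ℂ) ^ n * (1 - (p.2 : ℂ) ^ 2) *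
        (-n * g p + α * (p.2 : ℂ) ^ 2 * g p + euler α g p) := by
  have h1 : HasFDerivAt (fun q : ℝ × ℝ => q.1 ^ n * (1 - q.2 ^ 2)) _ p :=
    ((hasFDerivAt_fst (𝕜 := ℝ) (E := ℝ) (F := ℝ)).pow n).mul
      (((hasFDerivAt_snd (𝕜 := ℝ) (E := ℝ) (F := ℝ)).pow 2).const_sub 1)
  have h2 := (hg.differentiable (by simp) p).hasFDerivAt
  have e : (fun q : ℝ × ℝ => (q.1 : ℂ) ^ n * (1 - (q.2 : ℂ) ^ 2) * g q) =
      (fun q : ℝ × ℝ => q.1 ^ n * (1 - q.2 ^ 2)) • g := by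
    ext q
    rw [Pi.smul_apply', Complex.real_smul]
    push_cast
    rfl
  rw [euler, e, (h1.smul h2).fderiv, euler]
  rcases n with _ | n
  · simp
    ring
  · simp
    ring

open scoped ContDiff in
/-- At `V = 1` the Euler vector field is tangent to the line `V = 1`. -/
theorem euler_eq_zero_of_const {g : ℝ × ℝ → ℂ} (hg : ContDiff ℝ ∞ g) {d : ℂ}
    (h : ∀ X, g (X, 1) = d) (X : ℝ) : euler α g (X, 1) = 0 := by
  have h1 : HasDerivAt (fun t : ℝ => (t, (1 : ℝ))) (1, 0) X :=
    (hasDerivAt_id X).prodMk (hasDerivAt_const X 1)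
  have h2 : HasDerivAt (fun t : ℝ => g (t, 1)) (fderiv ℝ g (X, 1) (1, 0)) X :=
    (hg.differentiable (by simp) (X, 1)).hasFDerivAt.comp_hasDerivAt X h1
  simp only [h] at h2
  have h3 : fderiv ℝ g (X, 1) (1, 0) = 0 := h2.unique (hasDerivAt_const X d)
  have e : ((-X, -(α / 2) * ((1 : ℝ) - 1 ^ 3)) : ℝ × ℝ) = (-X) • ((1 : ℝ), (0 : ℝ)) := by
    ext <;> simp
  rw [euler, e, map_smul, h3, smul_zero]

open scoped ContDiff in
/-- The increments of the iterates. The factor `X^(k+2)` gives the decay at infinity, the factor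
`1 - V² = θ x^α V²` the smallness in `θ`; on `V = 1`, that is at `θ = 0`, the remaining factor is
constant. -/
theorem exists_slowReflection_sub_eq (α : ℝ) (k : ℕ) : ∃ Q : ℝ × ℝ → ℂ, ContDiff ℝ ∞ Q ∧
    (∀ p, slowReflection α (k + 1) p - slowReflection α k p =
      (p.1 : ℂ) ^ (k + 2) * (1 - (p.2 : ℂ) ^ 2) * (p.2 * Q p)) ∧
    ∀ X, Q (X, 1) = ((descPochhammer ℝ (k + 2)).eval α : ℝ) / (2 * Complex.I) ^ (k + 4) := by
  have c1 := contDiff_ofReal_fst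
  have c2 := contDiff_ofReal_snd
  have c3 := contDiff_reducedM (α := α)
  have hI : Complex.I ^ 2 = -1 := Complex.I_sq
  have hI4 : (2 * Complex.I) ^ 4 = 16 := by
    rw [mul_pow, show Complex.I ^ 4 = (Complex.I ^ 2) ^ 2 by ring, hI]; norm_num
  induction k with
  | zero =>
    refine ⟨fun p => -(1 / 4) * (p.2 * reducedM α p), by fun_prop, fun p => ?_, fun X => ?_⟩
    · have h0 : euler α (slowReflection α 0) p = 0 := by
        simp [euler, slowReflection]
      simp only [slowReflection, zero_add] at h0 ⊢
      rw [h0, slowM]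
      have := Complex.I_ne_zero
      field_simp
      simp only [Pi.zero_apply, hI]
      ring
    · simp [reducedM, descPochhammer_succ_right, hI4]
      ring
  | succ k ih =>
    obtain ⟨Q, hQ, hQ1, hQ2⟩ := ih
    have r0 := contDiff_slowReflection (α := α) k
    have r1 := contDiff_slowReflection (α := α) (k + 1)
    have hg : ContDiff ℝ ∞ fun p : ℝ × ℝ => (p.2 : ℂ) * Q p := by fun_prop
    have he := contDiff_euler (α := α) hg
    refine ⟨fun p => 1 / (2 * Complex.I) * (-(k + 2 : ℕ) * (p.2 * Q p) +
      α * (p.2 : ℂ) ^ 2 * (p.2 * Q p) + euler α (fun p => (p.2 : ℂ) * Q p) p +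
      1 / (2 * Complex.I) * p.1 * (1 - (p.2 : ℂ) ^ 2) * p.2 * reducedM α p * (p.2 * Q p) *
        (2 + slowReflection α k p + slowReflection α (k + 1) p)), ?_, fun p => ?_, fun X => ?_⟩
    · fun_prop
    · have h1 : euler α (slowReflection α (k + 1)) p - euler α (slowReflection α k) p =
          euler α (fun q => (q.1 : ℂ) ^ (k + 2) * (1 - (q.2 : ℂ) ^ 2) * (q.2 * Q q)) p := by
        rw [← funext hQ1]
        simp only [euler]
        rw [← sub_apply]
        congr 1
        exact (fderiv_sub (r1.differentiable (by simp) p) (r0.differentiable (by simp) p)).symm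
      rw [euler_mul_one_sub_sq _ hg] at h1
      have h2 : slowReflection α (k + 1 + 1) p - slowReflection α (k + 1) p =
          p.2 / (2 * Complex.I) * (p.1 * (euler α (slowReflection α (k + 1)) p -
            euler α (slowReflection α k) p) + slowM α p / (2 * Complex.I) *
            ((slowReflection α (k + 1) p - slowReflection α k p) *
              (2 + slowReflection α k p + slowReflection α (k + 1) p))) := by
        conv_lhs => rw [slowReflection]
        conv_lhs => arg 2; rw [slowReflection]
        ring
      rw [h2, h1, hQ1, slowM]
      ring
    · have h1 : euler α (fun p => (p.2 : ℂ) * Q p) (X, 1) = 0 :=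
        euler_eq_zero_of_const hg (fun X => by rw [Complex.ofReal_one, one_mul, hQ2 X]) X
      have := Complex.I_ne_zero
      simp only [h1, hQ2, descPochhammer_succ_right _ (k + 2), Polynomial.eval_mul,
        Polynomial.eval_sub, Polynomial.eval_X, Polynomial.eval_natCast]
      push_cast
      field_simp
      ring

theorem iteratedDeriv_rpow (α x : ℝ) (n : ℕ) :
    iteratedDeriv n (fun t : ℝ => t ^ α) x = (descPochhammer ℝ n).eval α * x ^ (α - n) := by
  rw [iteratedDeriv_eq_iterate, Real.iter_deriv_rpow_const]

open scoped ContDiff in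
/-- Smooth functions of `1/x` and `c` are bounded on `[x₀, ∞)` uniformly in `θ`, because
`(1/x, c)` stays in the compact set `[0, 1/x₀] × [0, 1]`. -/
theorem exists_norm_slow_le {G : ℝ × ℝ → ℂ} (hG : ContDiff ℝ ∞ G) (hx₀ : 0 < x₀) :
    ∃ C, ∀ θ, 0 ≤ θ → ∀ x ∈ Ici x₀, ‖G (x⁻¹, c α θ x)‖ ≤ C := by
  obtain ⟨C, hC⟩ := (isCompact_Icc.prod isCompact_Icc : IsCompact
    (Icc (0 : ℝ) x₀⁻¹ ×ˢ Icc (0 : ℝ) 1)).exists_bound_of_continuousOn hG.continuous.continuousOn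
  refine ⟨C, fun θ hθ x hx => hC _ ⟨⟨?_, ?_⟩, (c_pos hθ x).le, c_le_one hθ x⟩⟩
  · exact inv_nonneg.2 (hx₀.le.trans hx)
  · exact inv_anti₀ hx₀ hx

theorem inv_pow_mul_rpow (hx : 0 < x) (k : ℕ) : x⁻¹ ^ (k + 2) * x ^ α = x ^ (α - (k + 2 : ℕ)) := by
  rw [Real.rpow_sub hx, Real.rpow_natCast, inv_pow, div_eq_inv_mul]

theorem exists_norm_slowReflection_sub_le (hx₀ : 0 < x₀) (k : ℕ) :
    ∃ C, ∀ θ, 0 ≤ θ → ∀ x ∈ Ici x₀, ‖2 * Complex.I / c α θ x *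
      (slowReflection α k (x⁻¹, c α θ x) - slowReflection α (k + 1) (x⁻¹, c α θ x))‖ ≤
        C * x ^ (α - (k + 2 : ℕ)) * θ := by
  obtain ⟨Q, hQ, hQ1, -⟩ := exists_slowReflection_sub_eq α k
  obtain ⟨C, hC⟩ := exists_norm_slow_le (α := α) hQ hx₀
  refine ⟨2 * C, fun θ hθ x hx => ?_⟩
  have hx0 : 0 < x := hx₀.trans_le hx
  have hc := c_pos (α := α) hθ x
  have e : 2 * Complex.I / c α θ x *
      (slowReflection α k (x⁻¹, c α θ x) - slowReflection α (k + 1) (x⁻¹, c α θ x)) =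
      (((-2 * (x⁻¹ ^ (k + 2) * (1 - c α θ x ^ 2)) : ℝ)) : ℂ) *
        (Complex.I * Q (x⁻¹, c α θ x)) := by
    rw [← neg_sub, hQ1]
    have : (c α θ x : ℂ) ≠ 0 := Complex.ofReal_ne_zero.2 hc.ne'
    push_cast
    field_simp
  have h2 := one_sub_c_sq_nonneg (α := α) hθ hx0
  rw [e, norm_mul, norm_mul, Complex.norm_real, Complex.norm_I, one_mul, Real.norm_eq_abs, abs_mul,
    abs_of_nonneg (by positivity : 0 ≤ x⁻¹ ^ (k + 2) * (1 - c α θ x ^ 2)), abs_neg, abs_two,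
    ← inv_pow_mul_rpow hx0]
  have h3 := hC θ hθ x hx
  calc 2 * (x⁻¹ ^ (k + 2) * (1 - c α θ x ^ 2)) * ‖Q (x⁻¹, c α θ x)‖
      ≤ 2 * (x⁻¹ ^ (k + 2) * (θ * x ^ α)) * C := by
        gcongr
        exact one_sub_c_sq_le hθ hx0
    _ = _ := by ring

theorem tendsto_one_sub_c_sq_div (hx : 0 < x) :
    Tendsto (fun θ => (1 - c α θ x ^ 2) / θ) (𝓝[>] 0) (𝓝 (x ^ α)) := by
  have h : Tendsto (fun θ => x ^ α * c α θ x ^ 2) (𝓝[>] 0) (𝓝 (x ^ α * 1 ^ 2)) :=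
    tendsto_const_nhds.mul ((tendsto_c α x).pow 2)
  rw [one_pow, mul_one] at h
  refine h.congr' ?_
  filter_upwards [self_mem_nhdsWithin] with θ hθ
  have h0 : 0 < θ := hθ
  rw [one_sub_c_sq h0.le hx]
  field_simp

theorem tendsto_slowReflection_sub_div (hx : 0 < x) (k : ℕ) :
    Tendsto (fun θ => (slowReflection α (k + 1) (x⁻¹, c α θ x) -
        slowReflection α k (x⁻¹, c α θ x)) / (θ : ℂ)) (𝓝[>] 0)
      (𝓝 ((iteratedDeriv (k + 2) (fun t : ℝ => t ^ α) x : ℝ) / (2 * Complex.I) ^ (k + 4))) := by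
  obtain ⟨Q, hQ, hQ1, hQ2⟩ := exists_slowReflection_sub_eq α k
  have h1 : Tendsto (fun θ => (((1 - c α θ x ^ 2) / θ : ℝ) : ℂ)) (𝓝[>] 0) (𝓝 ((x ^ α : ℝ) : ℂ)) :=
    (Complex.continuous_ofReal.tendsto _).comp (tendsto_one_sub_c_sq_div hx)
  have h2 : Tendsto (fun θ => (c α θ x : ℂ)) (𝓝[>] 0) (𝓝 ((1 : ℝ) : ℂ)) :=
    (Complex.continuous_ofReal.tendsto _).comp (tendsto_c α x)
  have h3 : Tendsto (fun θ => Q (x⁻¹, c α θ x)) (𝓝[>] 0) (𝓝 (Q (x⁻¹, 1))) :=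
    (hQ.continuous.tendsto _).comp (tendsto_const_nhds.prodMk_nhds (tendsto_c α x))
  have h4 : Tendsto (fun θ => ((x⁻¹ ^ (k + 2) : ℝ) : ℂ) * (((1 - c α θ x ^ 2) / θ : ℝ) : ℂ) *
      (c α θ x * Q (x⁻¹, c α θ x))) (𝓝[>] 0) _ :=
    (tendsto_const_nhds.mul h1).mul (h2.mul h3)
  rw [hQ2, ← Complex.ofReal_mul, inv_pow_mul_rpow hx, Complex.ofReal_one, one_mul,
    ← mul_div_assoc, ← Complex.ofReal_mul, mul_comm (x ^ _), ← iteratedDeriv_rpow] at h4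
  refine h4.congr fun θ => ?_
  rw [hQ1]
  push_cast
  ring

/-- The values of the approximations to first order in `θ`, by telescoping. -/
theorem tendsto_slowReflection_div (hx : 0 < x) (n : ℕ) :
    Tendsto (fun θ => slowReflection α n (x⁻¹, c α θ x) / (θ : ℂ)) (𝓝[>] 0)
      (𝓝 (∑ k ∈ Finset.range n,
        (iteratedDeriv (k + 2) (fun t : ℝ => t ^ α) x : ℝ) / (2 * Complex.I) ^ (k + 4))) := by
  refine (tendsto_finsetSum _ fun k _ => tendsto_slowReflection_sub_div hx k).congr fun θ => ?_
  rw [← Finset.sum_div, Finset.sum_range_sub fun k => slowReflection α k (x⁻¹, c α θ x)]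
  simp [slowReflection]

/-! ### The reflection coefficient in terms of the approximate one -/

theorem intervalIntegrable_of_integrableOn_Ioi {F : ℝ → ℂ} (hF : IntegrableOn F (Ioi x₀))
    (hx : x₀ ≤ x) : IntervalIntegrable F volume x₀ x :=
  (intervalIntegrable_iff_integrableOn_Ioc_of_le hx).2 (hF.mono_set Ioc_subset_Ioi_self)

theorem hasDerivAt_primitive_Ioi {F : ℝ → ℂ} (hF : IntegrableOn F (Ioi x₀))
    (hc : ContinuousOn F (Ioi x₀)) (hx : x ∈ Ioi x₀) :
    HasDerivAt (fun x => ∫ y in x₀..x, F y) (F x) x :=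
  intervalIntegral.integral_hasDerivAt_right
    (intervalIntegrable_of_integrableOn_Ioi hF (le_of_lt hx))
    (hc.stronglyMeasurableAtFilter isOpen_Ioi x hx) (hc.continuousAt (Ioi_mem_nhds hx))

theorem integral_Ioi_eqOn {F : ℝ → ℂ} (hF : IntegrableOn F (Ioi x₀)) :
    EqOn (fun x => ∫ y in Ioi x, F y) (fun x => (∫ y in Ioi x₀, F y) - ∫ y in x₀..x, F y)
      (Ici x₀) := fun x hx => by
  simp only [← intervalIntegral.integral_Ioi_sub_Ioi hF hx, sub_sub_cancel]

theorem hasDerivAt_integral_Ioi {F : ℝ → ℂ} (hF : IntegrableOn F (Ioi x₀))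
    (hc : ContinuousOn F (Ioi x₀)) (hx : x ∈ Ioi x₀) :
    HasDerivAt (fun x => ∫ y in Ioi x, F y) (-F x) x :=
  ((hasDerivAt_primitive_Ioi hF hc hx).const_sub _).congr_of_eventuallyEq <|
    (integral_Ioi_eqOn hF).eventuallyEq_of_mem (Ici_mem_nhds hx)

theorem tendsto_integral_Ioi_atTop {F : ℝ → ℂ} (hF : IntegrableOn F (Ioi x₀)) :
    Tendsto (fun x => ∫ y in Ioi x, F y) atTop (𝓝 0) := by
  have h := (intervalIntegral_tendsto_integral_Ioi x₀ hF tendsto_id).const_sub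
    (∫ y in Ioi x₀, F y)
  rw [sub_self] at h
  exact h.congr' ((integral_Ioi_eqOn hF).symm.eventuallyEq_of_mem (Ici_mem_atTop x₀))

theorem norm_integral_M_mul_le (hα : 0 < α) (hx₀ : 0 < x₀) (hθ : 0 ≤ θ) {f : ℝ → ℂ} {C : ℝ}
    (hC : ∀ x ∈ Ici x₀, ‖f x‖ ≤ C) (hx : x ∈ Ici x₀) :
    ‖∫ y in x₀..x, (M α θ y : ℂ) * f y‖ ≤ (∫ y in Ioi x₀, |M α θ y|) * C := by
  have hM : IntegrableOn (fun y => |M α θ y| * C) (Ioi x₀) :=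
    (integrableOn_M hα hx₀ hθ).abs.mul_const C
  have hC0 : 0 ≤ C := (norm_nonneg _).trans (hC x hx)
  rw [intervalIntegral.integral_of_le hx, ← integral_mul_const]
  refine (norm_integral_le_of_norm_le (hM.mono_set Ioc_subset_Ioi_self)
    ((ae_restrict_iff' measurableSet_Ioc).2 (ae_of_all _ fun y hy => ?_))).trans
    (setIntegral_mono_set hM (ae_of_all _ fun y => by positivity)
      Ioc_subset_Ioi_self.eventuallyLE)
  rw [norm_mul, Complex.norm_real, Real.norm_eq_abs]
  exact mul_le_mul_of_nonneg_left (hC y hy.1.le) (abs_nonneg _)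

/-- The amplitude of the component `e^{-2iφ}` of `S`; the other component is `R` itself, taken at
the running point. -/
def amplitude (α θ x₀ : ℝ) (S : ℝ → ℂ) (x : ℝ) : ℂ :=
  1 + 1 / (2 * Complex.I) *
    ∫ y in x₀..x, (M α θ y : ℂ) * S y * Complex.exp (2 * Complex.I * (phi α θ y : ℂ))

theorem IsVolterraSolution.eq_add {S : ℝ → ℂ} (hS : IsVolterraSolution α θ x₀ S)
    (hx : x ∈ Ici x₀) : S x =
      amplitude α θ x₀ S x * Complex.exp (-2 * Complex.I * (phi α θ x : ℂ)) + R α θ x S := by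
  rw [hS.equation x hx, K_eq, amplitude, R]
  ring

/-- The `n`-th approximate local reflection coefficient as a function of `x`. -/
def approxReflection (α θ : ℝ) (n : ℕ) (x : ℝ) : ℂ := slowReflection α n (x⁻¹, c α θ x)

/-- The residual of the `n`-th approximate local reflection coefficient in the Riccati equation. -/
def residual (α θ : ℝ) (n : ℕ) (x : ℝ) : ℂ :=
  2 * Complex.I / c α θ x * (approxReflection α θ n x - approxReflection α θ (n + 1) x)

/-- The factor that absorbs the feedback of the error of the approximation on its own derivative. -/
def integratingFactor (α θ x₀ : ℝ) (n : ℕ) (x : ℝ) : ℂ :=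
  Complex.exp (∫ y in x₀..x,
    (M α θ y : ℂ) * (1 / (2 * Complex.I) * (1 + approxReflection α θ n y)))

theorem residual_eq (hθ : 0 ≤ θ) (hx : 0 < x) (n : ℕ) :
    residual α θ n x = 2 * Complex.I / c α θ x * approxReflection α θ n x -
      (x⁻¹ : ℝ) * euler α (slowReflection α n) (x⁻¹, c α θ x) -
      M α θ x / (2 * Complex.I) * (1 + approxReflection α θ n x) ^ 2 := by
  have hc : (c α θ x : ℂ) ≠ 0 := Complex.ofReal_ne_zero.2 (c_pos hθ x).ne'
  have hI := Complex.I_ne_zero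
  rw [residual, approxReflection, approxReflection, slowReflection, M_eq_slowM hθ hx]
  field_simp
  ring

theorem continuousOn_slow (hα : 0 < α) (hθ : 0 ≤ θ) {G : ℝ × ℝ → ℂ} (hG : Continuous G) :
    ContinuousOn (fun x => G (x⁻¹, c α θ x)) (Ioi 0) :=
  hG.comp_continuousOn ((continuousOn_inv₀.mono fun _ hx => (mem_Ioi.1 hx).ne').prodMk
    (continuous_c hα hθ).continuousOn)

theorem continuousOn_approxReflection (hα : 0 < α) (hθ : 0 ≤ θ) (n : ℕ) :
    ContinuousOn (approxReflection α θ n) (Ioi 0) :=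
  continuousOn_slow hα hθ (contDiff_slowReflection n).continuous

theorem continuousOn_residual (hα : 0 < α) (hθ : 0 ≤ θ) (n : ℕ) :
    ContinuousOn (residual α θ n) (Ioi 0) := by
  refine ContinuousOn.mul ?_ ((continuousOn_approxReflection hα hθ n).sub
    (continuousOn_approxReflection hα hθ (n + 1)))
  exact (continuous_const.div (Complex.continuous_ofReal.comp (continuous_c hα hθ)) fun x =>
    Complex.ofReal_ne_zero.2 (c_pos hθ x).ne').continuousOn

theorem tendsto_c_atTop (hα : 0 < α) (hθ : 0 < θ) : Tendsto (c α θ) atTop (𝓝 0) := by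
  refine tendsto_inv_atTop_zero.comp (Real.tendsto_sqrt_atTop.comp
    (tendsto_atTop_add_const_left _ _ (Tendsto.const_mul_atTop hθ ?_)))
  refine (tendsto_rpow_atTop hα).congr' ?_
  filter_upwards [eventually_ge_atTop 0] with x hx
  rw [max_eq_left hx]

theorem tendsto_approxReflection_atTop (hα : 0 < α) (hθ : 0 < θ) (n : ℕ) :
    Tendsto (approxReflection α θ n) atTop (𝓝 0) := by
  have h : Tendsto (approxReflection α θ n) atTop (𝓝 (slowReflection α n (0, 0))) :=
    ((contDiff_slowReflection n).continuous.tendsto _).comp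
      (tendsto_inv_atTop_zero.prodMk_nhds (tendsto_c_atTop hα hθ))
  have h0 : slowReflection α n (0, 0) = 0 := by cases n <;> simp [slowReflection]
  rwa [h0] at h

/-- Data common to the estimates below: `θ` is positive and small enough for `S` and the `n`-th
approximation to be controlled, `C` being a bound for the latter. -/
structure SmallParameter (α θ x₀ : ℝ) (n : ℕ) (C : ℝ) (S : ℝ → ℂ) : Prop where
  pos : 0 < θ
  sol : IsVolterraSolution α θ x₀ S
  approx_le : ∀ x ∈ Ici x₀, ‖approxReflection α θ n x‖ ≤ C
  integral_le : ∫ y in Ioi x₀, |M α θ y| ≤ 1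
  integral_mul_le : (∫ y in Ioi x₀, |M α θ y|) * (1 + C) ≤ 1

namespace SmallParameter

variable {n : ℕ} {C : ℝ} {S : ℝ → ℂ}

theorem norm_le_two (h : SmallParameter α θ x₀ n C S) (hα : 0 < α) (hx₀ : 0 < x₀)
    (hx : x ∈ Ici x₀) : ‖S x‖ ≤ 2 :=
  h.sol.norm_le_two hα hx₀ h.pos.le h.integral_le hx

theorem norm_amplitude_sub_one_le (h : SmallParameter α θ x₀ n C S) (hα : 0 < α) (hx₀ : 0 < x₀)
    (hx : x ∈ Ici x₀) : ‖amplitude α θ x₀ S x - 1‖ ≤ ∫ y in Ioi x₀, |M α θ y| := by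
  have h1 := norm_integral_M_mul_le (C := 2) hα hx₀ h.pos.le
    (f := fun y => S y * Complex.exp (2 * Complex.I * (phi α θ y : ℂ)))
    (fun y hy => by rw [norm_mul, norm_exp_two_I_mul, mul_one]; exact h.norm_le_two hα hx₀ hy) hx
  simp only [← mul_assoc] at h1
  rw [amplitude, add_sub_cancel_left, norm_mul, norm_one_div_two_I]
  linarith

theorem norm_exponent_le (h : SmallParameter α θ x₀ n C S) (hα : 0 < α) (hx₀ : 0 < x₀)
    (hx : x ∈ Ici x₀) : ‖∫ y in x₀..x,
      (M α θ y : ℂ) * (1 / (2 * Complex.I) * (1 + approxReflection α θ n y))‖ ≤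
        (∫ y in Ioi x₀, |M α θ y|) * ((1 + C) / 2) := by
  refine norm_integral_M_mul_le hα hx₀ h.pos.le (fun y hy => ?_) hx
  rw [norm_mul, norm_one_div_two_I]
  have := (norm_add_le 1 (approxReflection α θ n y)).trans
    (add_le_add norm_one.le (h.approx_le y hy))
  linarith

theorem norm_integratingFactor_sub_one_le (h : SmallParameter α θ x₀ n C S) (hα : 0 < α)
    (hx₀ : 0 < x₀) (hx : x ∈ Ici x₀) :
    ‖integratingFactor α θ x₀ n x - 1‖ ≤ (∫ y in Ioi x₀, |M α θ y|) * (1 + C) := by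
  have h1 := h.norm_exponent_le hα hx₀ hx
  have h2 := h.integral_mul_le
  have h3 : 0 ≤ ∫ y in Ioi x₀, |M α θ y| := integral_nonneg fun _ => abs_nonneg _
  exact (Complex.norm_exp_sub_one_le (by linarith)).trans (by linarith)

theorem norm_amplitude_le (h : SmallParameter α θ x₀ n C S) (hα : 0 < α) (hx₀ : 0 < x₀)
    (hx : x ∈ Ici x₀) : ‖amplitude α θ x₀ S x‖ ≤ 2 := by
  have h1 := h.norm_amplitude_sub_one_le hα hx₀ hx
  have h2 := norm_le_norm_add_norm_sub' (amplitude α θ x₀ S x) 1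
  rw [norm_one] at h2
  linarith [h.integral_le]

theorem norm_integratingFactor_le (h : SmallParameter α θ x₀ n C S) (hα : 0 < α)
    (hx₀ : 0 < x₀) (hx : x ∈ Ici x₀) : ‖integratingFactor α θ x₀ n x‖ ≤ 2 := by
  have h1 := h.norm_integratingFactor_sub_one_le hα hx₀ hx
  have h2 := norm_le_norm_add_norm_sub' (integratingFactor α θ x₀ n x) 1
  rw [norm_one] at h2
  linarith [h.integral_mul_le]

theorem integrableOn_M_mul_S (h : SmallParameter α θ x₀ n C S) (hα : 0 < α) (hx₀ : 0 < x₀) :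
    IntegrableOn (fun y => (M α θ y : ℂ) * S y) (Ioi x₀) :=
  integrableOn_M_mul hα hx₀ h.pos.le h.sol.continuousOn fun _ hx => h.norm_le_two hα hx₀ hx

theorem continuousOn_amplitude (h : SmallParameter α θ x₀ n C S) (hα : 0 < α) (hx₀ : 0 < x₀) :
    ContinuousOn (amplitude α θ x₀ S) (Ici x₀) :=
  continuousOn_const.add (continuousOn_const.mul (continuousOn_primitive_Ici
    (integrableOn_M_mul_exp hα h.pos.le (h.integrableOn_M_mul_S hα hx₀))))

theorem integrableOn_exponent (h : SmallParameter α θ x₀ n C S) (hα : 0 < α) (hx₀ : 0 < x₀) :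
    IntegrableOn (fun y => (M α θ y : ℂ) *
      (1 / (2 * Complex.I) * (1 + approxReflection α θ n y))) (Ioi x₀) := by
  have hc : ContinuousOn (approxReflection α θ n) (Ici x₀) :=
    (continuousOn_approxReflection hα h.pos.le n).mono fun y hy => hx₀.trans_le hy
  refine integrableOn_M_mul (C := (1 + C) / 2) hα hx₀ h.pos.le (by fun_prop) fun y hy => ?_
  rw [norm_mul, norm_one_div_two_I]
  have := (norm_add_le 1 (approxReflection α θ n y)).trans
    (add_le_add norm_one.le (h.approx_le y hy))
  linarith

theorem continuousOn_integratingFactor (h : SmallParameter α θ x₀ n C S) (hα : 0 < α)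
    (hx₀ : 0 < x₀) : ContinuousOn (integratingFactor α θ x₀ n) (Ici x₀) :=
  (continuousOn_primitive_Ici (h.integrableOn_exponent hα hx₀)).cexp

/-- In the derivative of the error of the approximation `R ≈ ρ a e^{-2iφ}`, multiplied by the
integrating factor, only the residual survives. -/
theorem hasDerivAt_error (h : SmallParameter α θ x₀ n C S) (hα : 0 < α) (hx₀ : 0 < x₀)
    (hx : x ∈ Ioi x₀) :
    HasDerivAt (fun x => integratingFactor α θ x₀ n x * (R α θ x S -
      approxReflection α θ n x * Complex.exp (-2 * Complex.I * (phi α θ x : ℂ)) *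
        amplitude α θ x₀ S x))
      (integratingFactor α θ x₀ n x * amplitude α θ x₀ S x *
        Complex.exp (-2 * Complex.I * (phi α θ x : ℂ)) * residual α θ n x) x := by
  have hθ := h.pos.le
  have hx0 : 0 < x := hx₀.trans hx
  have hsub : Ioi x₀ ⊆ Ioi 0 := Ioi_subset_Ioi hx₀.le
  have cM : ContinuousOn (fun y => (M α θ y : ℂ)) (Ioi x₀) :=
    Complex.continuous_ofReal.comp_continuousOn ((continuousOn_M hα hθ).mono hsub)
  have cS : ContinuousOn S (Ioi x₀) := h.sol.continuousOn.mono Ioi_subset_Ici_self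
  have cρ := (continuousOn_approxReflection hα hθ n).mono hsub
  have cφ := continuous_phi hα hθ
  have iS := h.integrableOn_M_mul_S hα hx₀
  have dE := (hasDerivAt_primitive_Ioi (h.integrableOn_exponent hα hx₀) (by fun_prop) hx).cexp
  have dR := (hasDerivAt_integral_Ioi iS (by fun_prop) hx).const_mul (1 / (2 * Complex.I))
  have dA := ((hasDerivAt_primitive_Ioi (integrableOn_M_mul_exp hα hθ iS) (by fun_prop)
    hx).const_mul (1 / (2 * Complex.I))).const_add 1
  have dρ := hasDerivAt_slow (α := α) hθ hx0 (contDiff_slowReflection (α := α) n)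
  have dφ := (((hasDerivAt_phi hα hθ x).ofReal_comp).const_mul (-2 * Complex.I)).cexp
  refine (dE.mul (dR.sub ((dρ.mul dφ).mul dA))).congr_deriv ?_
  have hSx := h.sol.eq_add (mem_Ici_of_Ioi hx)
  have he : Complex.exp (-2 * Complex.I * (phi α θ x : ℂ)) *
      Complex.exp (2 * Complex.I * (phi α θ x : ℂ)) = 1 := by
    rw [← Complex.exp_add, ← Complex.exp_zero]
    congr 1
    ring
  rw [residual_eq hθ hx0]
  change integratingFactor α θ x₀ n x *
      (M α θ x * (1 / (2 * Complex.I) * (1 + approxReflection α θ n x))) *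
      (R α θ x S - approxReflection α θ n x * Complex.exp (-2 * Complex.I * (phi α θ x : ℂ)) *
        amplitude α θ x₀ S x) +
    integratingFactor α θ x₀ n x * (1 / (2 * Complex.I) * -(M α θ x * S x) -
      (((x⁻¹ : ℝ) * euler α (slowReflection α n) (x⁻¹, c α θ x) *
          Complex.exp (-2 * Complex.I * (phi α θ x : ℂ)) +
        approxReflection α θ n x * (Complex.exp (-2 * Complex.I * (phi α θ x : ℂ)) *
          (-2 * Complex.I * (1 / c α θ x : ℝ)))) * amplitude α θ x₀ S x +
      approxReflection α θ n x * Complex.exp (-2 * Complex.I * (phi α θ x : ℂ)) *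
        (1 / (2 * Complex.I) *
          (M α θ x * S x * Complex.exp (2 * Complex.I * (phi α θ x : ℂ)))))) = _
  rw [hSx, Complex.ofReal_div, Complex.ofReal_one]
  generalize Complex.exp (2 * Complex.I * (phi α θ x : ℂ)) = e' at he ⊢
  generalize Complex.exp (-2 * Complex.I * (phi α θ x : ℂ)) = e at he ⊢
  linear_combination (-(integratingFactor α θ x₀ n x * approxReflection α θ n x * M α θ x /
    (2 * Complex.I) * (amplitude α θ x₀ S x * e + R α θ x S))) * he

/-- The error of the approximation is the integral of its residual against bounded factors. -/
theorem R_eq (h : SmallParameter α θ x₀ n C S) (hα : 0 < α) (hx₀ : 0 < x₀)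
    (hint : IntegrableOn (fun x => integratingFactor α θ x₀ n x * amplitude α θ x₀ S x *
        Complex.exp (-2 * Complex.I * (phi α θ x : ℂ)) * residual α θ n x) (Ioi x₀)) :
    R α θ x₀ S = approxReflection α θ n x₀ * Complex.exp (-2 * Complex.I * (phi α θ x₀ : ℂ)) -
      ∫ x in Ioi x₀, integratingFactor α θ x₀ n x * amplitude α θ x₀ S x *
        Complex.exp (-2 * Complex.I * (phi α θ x : ℂ)) * residual α θ n x := by
  have iS := h.integrableOn_M_mul_S hα hx₀
  have cA := h.continuousOn_amplitude hα hx₀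
  have cE := h.continuousOn_integratingFactor hα hx₀
  have cR : ContinuousOn (fun x => R α θ x S) (Ici x₀) :=
    continuousOn_const.mul (continuousOn_integral_Ioi iS)
  have cρ := (continuousOn_approxReflection hα h.pos.le n).mono
    fun y (hy : y ∈ Ici x₀) => hx₀.trans_le hy
  have cφ := continuous_phi hα h.pos.le
  have hb {f : ℝ → ℂ} (hf : Tendsto f atTop (𝓝 0)) {g : ℝ → ℂ} (B : ℝ)
      (hg : ∀ x ∈ Ici x₀, ‖g x‖ ≤ B) : Tendsto (fun x => f x * g x) atTop (𝓝 0) :=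
    hf.zero_mul_isBoundedUnder_le
      ⟨B, eventually_map.2 (by filter_upwards [eventually_ge_atTop x₀] with x hx using hg x hx)⟩
  have hR : Tendsto (fun x => R α θ x S) atTop (𝓝 0) := by
    have := (tendsto_integral_Ioi_atTop iS).const_mul (1 / (2 * Complex.I))
    rwa [mul_zero] at this
  have hρ : Tendsto (fun x => approxReflection α θ n x *
      Complex.exp (-2 * Complex.I * (phi α θ x : ℂ)) * amplitude α θ x₀ S x) atTop (𝓝 0) :=
    hb (hb (tendsto_approxReflection_atTop hα h.pos n) 1 fun x _ => (norm_exp_neg_two_I_mul _).le)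
      2 fun x hx => h.norm_amplitude_le hα hx₀ hx
  have hlim := hb (sub_zero (0 : ℂ) ▸ hR.sub hρ) 2 fun x hx => h.norm_integratingFactor_le hα hx₀ hx
  simp only [mul_comm _ (integratingFactor α θ x₀ n _)] at hlim
  have key := integral_Ioi_of_hasDerivAt_of_tendsto
    (ContinuousOn.continuousWithinAt (s := Ici x₀) (by fun_prop) self_mem_Ici)
    (fun x hx => h.hasDerivAt_error hα hx₀ hx) hint hlim
  rw [key]
  simp [integratingFactor, amplitude]

end SmallParameter

/-! ### The limit of `R / θ` -/

/-- The order `[α]` of approximation is the first at which the residual is sure to be integrable. -/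
theorem integrableOn_rpow_sub_floor (α : ℝ) (hx₀ : 0 < x₀) :
    IntegrableOn (fun x : ℝ => x ^ (α - (⌊α⌋₊ + 2 : ℕ))) (Ioi x₀) := by
  refine integrableOn_Ioi_rpow_of_lt ?_ hx₀
  have := Nat.lt_floor_add_one α
  push_cast
  linarith

theorem exists_eventually_smallParameter (hα : 0 < α) (hx₀ : 0 < x₀) (n : ℕ) {S : ℝ → ℝ → ℂ}
    (hS : ∀ᶠ θ : ℝ in 𝓝[>] 0, IsVolterraSolution α θ x₀ (S θ)) :
    ∃ C, ∀ᶠ θ : ℝ in 𝓝[>] 0, SmallParameter α θ x₀ n C (S θ) := by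
  obtain ⟨C, hC⟩ := exists_norm_slow_le (α := α) (contDiff_slowReflection (α := α) n) hx₀
  have h1 := tendsto_integral_abs_M hα hx₀
  have h2 := h1.mul_const (1 + C)
  rw [zero_mul] at h2
  refine ⟨C, ?_⟩
  filter_upwards [hS, self_mem_nhdsWithin, h1.eventually_le_const zero_lt_one,
    h2.eventually_le_const zero_lt_one] with θ hθ h0 h3 h4
  exact ⟨h0, hθ, fun x hx => hC θ (le_of_lt h0) x hx, h3, h4⟩

theorem tendsto_exp_phi (hα : 0 < α) (x : ℝ) :
    Tendsto (fun θ => Complex.exp (-2 * Complex.I * (phi α θ x : ℂ))) (𝓝[>] 0)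
      (𝓝 (Complex.exp (-2 * Complex.I * (x : ℂ)))) :=
  ((by fun_prop : Continuous fun t : ℝ => Complex.exp (-2 * Complex.I * (t : ℂ))).tendsto x).comp
    (tendsto_phi hα x)

theorem tendsto_residual_div (hx : 0 < x) (n : ℕ) :
    Tendsto (fun θ => residual α θ n x / (θ : ℂ)) (𝓝[>] 0)
      (𝓝 (-((iteratedDeriv (n + 2) (fun t : ℝ => t ^ α) x : ℝ) / (2 * Complex.I) ^ (n + 3)))) := by
  have h1 : Tendsto (fun θ => (c α θ x : ℂ)) (𝓝[>] 0) (𝓝 ((1 : ℝ) : ℂ)) :=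
    (Complex.continuous_ofReal.tendsto _).comp (tendsto_c α x)
  have h2 := ((tendsto_const_nhds (x := -(2 * Complex.I))).div h1 (by simp)).mul
    (tendsto_slowReflection_sub_div (α := α) hx n)
  refine (h2.congr fun θ => ?_).trans_eq ?_
  · simp only [Pi.div_apply, residual, approxReflection]
    ring
  · have := Complex.I_ne_zero
    congr 1
    rw [Complex.ofReal_one]
    field_simp
    ring

theorem tendsto_integral_residual_div (hα : 0 < α) (hx₀ : 0 < x₀) {S : ℝ → ℝ → ℂ} {C : ℝ}
    (hS : ∀ᶠ θ : ℝ in 𝓝[>] 0, SmallParameter α θ x₀ ⌊α⌋₊ C (S θ)) :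
    (∀ᶠ θ : ℝ in 𝓝[>] 0, IntegrableOn (fun x => integratingFactor α θ x₀ ⌊α⌋₊ x *
        amplitude α θ x₀ (S θ) x * Complex.exp (-2 * Complex.I * (phi α θ x : ℂ)) *
        residual α θ ⌊α⌋₊ x) (Ioi x₀)) ∧
    Tendsto (fun θ => (∫ x in Ioi x₀, integratingFactor α θ x₀ ⌊α⌋₊ x *
        amplitude α θ x₀ (S θ) x * Complex.exp (-2 * Complex.I * (phi α θ x : ℂ)) *
        residual α θ ⌊α⌋₊ x) / (θ : ℂ)) (𝓝[>] 0)
      (𝓝 (∫ x in Ioi x₀, Complex.exp (-2 * Complex.I * (x : ℂ)) *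
        -((iteratedDeriv (⌊α⌋₊ + 2) (fun t : ℝ => t ^ α) x : ℝ) /
          (2 * Complex.I) ^ (⌊α⌋₊ + 3)))) := by
  set n := ⌊α⌋₊
  obtain ⟨D, hD⟩ := exists_norm_slowReflection_sub_le (α := α) hx₀ n
  have hint := integrableOn_rpow_sub_floor α hx₀
  have hmeas : ∀ᶠ θ : ℝ in 𝓝[>] 0, AEStronglyMeasurable (fun x => integratingFactor α θ x₀ n x *
      amplitude α θ x₀ (S θ) x * Complex.exp (-2 * Complex.I * (phi α θ x : ℂ)) *
      residual α θ n x) (volume.restrict (Ioi x₀)) := by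
    filter_upwards [hS] with θ hθ
    have c1 := (hθ.continuousOn_amplitude hα hx₀).mono Ioi_subset_Ici_self
    have c2 := (hθ.continuousOn_integratingFactor hα hx₀).mono Ioi_subset_Ici_self
    have c3 := (continuousOn_residual hα hθ.pos.le n).mono (Ioi_subset_Ioi hx₀.le)
    have c4 := continuous_phi hα hθ.pos.le
    exact ContinuousOn.aestronglyMeasurable (by fun_prop) measurableSet_Ioi
  have hbound : ∀ᶠ θ : ℝ in 𝓝[>] 0, ∀ x ∈ Ioi x₀, ‖integratingFactor α θ x₀ n x *
      amplitude α θ x₀ (S θ) x * Complex.exp (-2 * Complex.I * (phi α θ x : ℂ)) *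
      residual α θ n x‖ ≤ 4 * D * x ^ (α - (n + 2 : ℕ)) * θ := by
    filter_upwards [hS] with θ hθ x hx
    have hx' := mem_Ici_of_Ioi hx
    have h1 := hθ.norm_amplitude_le hα hx₀ hx'
    have h2 := hθ.norm_integratingFactor_le hα hx₀ hx'
    have h3 : ‖residual α θ n x‖ ≤ _ := hD θ hθ.pos.le x hx'
    rw [norm_mul, norm_mul, norm_mul, norm_exp_neg_two_I_mul, mul_one]
    calc _ ≤ 2 * 2 * (D * x ^ (α - (n + 2 : ℕ)) * θ) := by gcongr
      _ = _ := by ring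
  constructor
  · filter_upwards [hmeas, hbound] with θ h1 h2
    exact ((hint.const_mul (4 * D)).mul_const θ).mono' h1
      ((ae_restrict_iff' measurableSet_Ioi).2 (ae_of_all _ h2))
  simp only [← integral_div]
  refine tendsto_integral_filter_of_dominated_convergence
    (fun x => 4 * D * x ^ (α - (n + 2 : ℕ))) ?_ ?_ (hint.const_mul (4 * D)) ?_
  · filter_upwards [hmeas] with θ h 
    simpa only [div_eq_mul_inv] using h.mul_const (θ : ℂ)⁻¹
  · filter_upwards [hbound, self_mem_nhdsWithin] with θ h h0
    refine (ae_restrict_iff' measurableSet_Ioi).2 (ae_of_all _ fun x hx => ?_)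
    have h0 : 0 < θ := h0
    rw [norm_div, Complex.norm_real, Real.norm_of_nonneg h0.le, div_le_iff₀ h0]
    exact h x hx
  · refine (ae_restrict_iff' measurableSet_Ioi).2 (ae_of_all _ fun x hx => ?_)
    have hx' := mem_Ici_of_Ioi hx
    have hM := tendsto_integral_abs_M hα hx₀
    have hA : Tendsto (fun θ => amplitude α θ x₀ (S θ) x) (𝓝[>] 0) (𝓝 1) := by
      rw [tendsto_iff_norm_sub_tendsto_zero]
      refine squeeze_zero' (Eventually.of_forall fun _ => norm_nonneg _) ?_ hM
      filter_upwards [hS] with θ hθ using hθ.norm_amplitude_sub_one_le hα hx₀ hx'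
    have hE : Tendsto (fun θ => integratingFactor α θ x₀ n x) (𝓝[>] 0) (𝓝 1) := by
      rw [tendsto_iff_norm_sub_tendsto_zero]
      refine squeeze_zero' (Eventually.of_forall fun _ => norm_nonneg _) ?_
        (by simpa using hM.mul_const (1 + C))
      filter_upwards [hS] with θ hθ using hθ.norm_integratingFactor_sub_one_le hα hx₀ hx'
    have h := ((hE.mul hA).mul (tendsto_exp_phi hα x)).mul
      (tendsto_residual_div (α := α) (hx₀.trans hx) n)
    simp only [one_mul] at h
    exact h.congr fun θ => (mul_div_assoc _ _ _).symm

/-- The limit of `R / θ`, by one formula for all `α > 0`; for `α < 1` its sum is empty. -/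
theorem tendsto_R_div (hα : 0 < α) (hx₀ : 0 < x₀) {S : ℝ → ℝ → ℂ}
    (hS : ∀ᶠ θ : ℝ in 𝓝[>] 0, IsVolterraSolution α θ x₀ (S θ)) :
    Tendsto (fun θ : ℝ => R α θ x₀ (S θ) / (θ : ℂ)) (𝓝[>] 0)
      (𝓝 (1 / (2 * Complex.I) *
        (Complex.exp (-2 * Complex.I * (x₀ : ℂ)) *
            ∑ p ∈ Finset.Icc 2 (⌊α⌋₊ + 1),
              ((iteratedDeriv p (fun t : ℝ => t ^ α) x₀ : ℝ) : ℂ) / (2 * Complex.I) ^ (p + 1) +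
          ∫ y in Ioi x₀,
            Complex.exp (-2 * Complex.I * (y : ℂ)) / (2 * Complex.I) ^ (⌊α⌋₊ + 2) *
              ((iteratedDeriv (⌊α⌋₊ + 2) (fun t : ℝ => t ^ α) y : ℝ) : ℂ)))) := by
  obtain ⟨C, hC⟩ := exists_eventually_smallParameter hα hx₀ ⌊α⌋₊ hS
  obtain ⟨hint, hlim⟩ := tendsto_integral_residual_div hα hx₀ hC
  have hI := Complex.I_ne_zero
  refine ((((tendsto_slowReflection_div (α := α) hx₀ ⌊α⌋₊).mul
    (tendsto_exp_phi hα x₀)).sub hlim).congr' ?_).trans_eq ?_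
  · filter_upwards [hC, hint] with θ h1 h2
    rw [h1.R_eq hα hx₀ h2, approxReflection]
    ring
  · congr 1
    rw [mul_add, ← integral_const_mul, sub_eq_add_neg, ← integral_neg]
    congr 1
    · have e : Finset.Icc 2 (⌊α⌋₊ + 1) = Finset.Ico (0 + 2) (⌊α⌋₊ + 2) := by
        ext; simp; omega
      rw [e, ← Finset.sum_Ico_add', ← Finset.range_eq_Ico, mul_comm, mul_left_comm]
      congr 1
      rw [Finset.mul_sum]
      refine Finset.sum_congr rfl fun k _ => ?_
      field_simp
      ring
    · refine integral_congr_ae (ae_of_all _ fun y => ?_)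
      field_simp
      ring

theorem iteratedDeriv_two_rpow (α x : ℝ) :
    iteratedDeriv 2 (fun t : ℝ => t ^ α) x = α * (α - 1) * x ^ (α - 2) := by
  rw [iteratedDeriv_rpow]
  simp [descPochhammer_succ_right]

end FractionalRamp

end

theorem propositionp (α x₀ : ℝ) (hα : 0 < α) (hx₀ : 0 < x₀) :
    -- for small `θ > 0`, `M` is integrable with `∫ |M| < 2`, and the Volterra equation is
    -- uniquely solvable on `[x₀, ∞)` among bounded continuous functions
    (∀ᶠ θ : ℝ in 𝓝[>] 0,
      IntegrableOn (FractionalRamp.M α θ) (Ioi x₀) ∧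
      (∫ y in Ioi x₀, |FractionalRamp.M α θ y|) < 2 ∧
      (∃ S : ℝ → ℂ, FractionalRamp.IsVolterraSolution α θ x₀ S) ∧
      (∀ S S' : ℝ → ℂ, FractionalRamp.IsVolterraSolution α θ x₀ S →
        FractionalRamp.IsVolterraSolution α θ x₀ S' → EqOn S S' (Ici x₀))) ∧
    -- the integrals in the limits converge absolutely, and the limits are as claimed
    (1 ≤ α →
      IntegrableOn (fun y : ℝ => iteratedDeriv (⌊α⌋₊ + 2) (fun t : ℝ => t ^ α) y) (Ioi x₀) ∧
      ∀ S : ℝ → ℝ → ℂ,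
        (∀ᶠ θ : ℝ in 𝓝[>] 0, FractionalRamp.IsVolterraSolution α θ x₀ (S θ)) →
        Tendsto (fun θ : ℝ => FractionalRamp.R α θ x₀ (S θ) / (θ : ℂ)) (𝓝[>] 0)
          (𝓝 (1 / (2 * Complex.I) *
            (Complex.exp (-2 * Complex.I * (x₀ : ℂ)) *
                ∑ p ∈ Finset.Icc 2 (⌊α⌋₊ + 1),
                  ((iteratedDeriv p (fun t : ℝ => t ^ α) x₀ : ℝ) : ℂ) /
                    (2 * Complex.I) ^ (p + 1) +
              ∫ y in Ioi x₀,
                Complex.exp (-2 * Complex.I * (y : ℂ)) / (2 * Complex.I) ^ (⌊α⌋₊ + 2) *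
                  ((iteratedDeriv (⌊α⌋₊ + 2) (fun t : ℝ => t ^ α) y : ℝ) : ℂ))))) ∧
    (α < 1 →
      IntegrableOn (fun y : ℝ => y ^ (α - 2)) (Ioi x₀) ∧
      ∀ S : ℝ → ℝ → ℂ,
        (∀ᶠ θ : ℝ in 𝓝[>] 0, FractionalRamp.IsVolterraSolution α θ x₀ (S θ)) →
        Tendsto (fun θ : ℝ => FractionalRamp.R α θ x₀ (S θ) / (θ : ℂ)) (𝓝[>] 0)
          (𝓝 (((α * (α - 1) : ℝ) : ℂ) / (2 * Complex.I) ^ 3 *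
            ∫ y in Ioi x₀,
              ((y ^ (α - 2) : ℝ) : ℂ) * Complex.exp (-2 * Complex.I * (y : ℂ))))) := by
  refine ⟨?_, fun _ => ⟨?_, fun S hS => FractionalRamp.tendsto_R_div hα hx₀ hS⟩,
    fun h1 => ⟨integrableOn_Ioi_rpow_of_lt (by linarith) hx₀, fun S hS => ?_⟩⟩
  · filter_upwards [self_mem_nhdsWithin,
      (FractionalRamp.tendsto_integral_abs_M hα hx₀).eventually_lt_const two_pos] with θ h0 hM
    have hθ : 0 ≤ θ := le_of_lt h0
    exact ⟨FractionalRamp.integrableOn_M hα hx₀ hθ, hM,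
      FractionalRamp.exists_isVolterraSolution hα hx₀ hθ hM,
      fun S S' hS hS' => hS.eqOn hα hx₀ hθ hM hS'⟩
  · simp only [FractionalRamp.iteratedDeriv_rpow]
    exact (FractionalRamp.integrableOn_rpow_sub_floor α hx₀).const_mul _
  · have h := FractionalRamp.tendsto_R_div hα hx₀ hS
    have hI := Complex.I_ne_zero
    rw [Nat.floor_eq_zero.2 h1] at h
    convert h using 2
    rw [Finset.Icc_eq_empty (by norm_num), Finset.sum_empty, mul_zero, zero_add,
      ← integral_const_mul, ← integral_const_mul]
    refine integral_congr_ae (ae_of_all _ fun y => ?_)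
    simp only [zero_add, FractionalRamp.iteratedDeriv_two_rpow]
    push_cast
    field_simp
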